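/- Let $P$ be a finite partially ordered set with $n$ elements. A subset $J\subseteq P$ is an order ideal if $j\in J$ and $i\le_P j$ imply $i\in J$; it is a connected order ideal if moreover it is non-empty and its Hasse diagram is a connected graph. Let $G_P$ be the simple graph whose vertices are the connected order ideals of $P$, two of them, $J_a$ and $J_b$, being adjacent if and only if $J_a\cap J_b\neq\emptyset$, $J_a\not\subseteq J_b$ and $J_b\not\subseteq J_a$. Let $C_1,\dots,C_h$ be the connected components of $G_P$, and let $\mathscr{M}(C_r)$ be the set of maximum independent sets of $C_r$, that is, of the independent sets of $C_r$ with the largest possible number of vertices. Label the elements of $P$ by $1,\dots,n$ through an arbitrary bijection (not necessarily a natural labeling), and let $\mathcal{L}(P)$ be the set of linear extensions of $P$: the permutations $w=w_1w_2\cdots w_n$ of $\{1,\dots,n\}$ such that $i<j$ whenever $w_i<_P w_j$. Then $$|\mathcal{L}(P)|=n!\prod_{r=1}^{h}\ \sum_{M_r\in\mathscr{M}(C_r)}\frac{1}{\prod_{J\in M_r}|J|}.$$ In particular, the number of linear extensions does not depend on the labeling. -/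

import Mathlib

namespace PosetCount

/-- The connected order ideals of `P`: the down-sets `J` whose Hasse diagram (as an induced
subposet) is a connected graph. Connectedness of a graph includes non-emptiness. -/
abbrev ConnIdeal (P : Type*) [PartialOrder P] : Type _ :=
  {J : Set P // IsLowerSet J ∧ (SimpleGraph.hasse J).Connected}

/-- The graph `G_P` on the connected order ideals of `P`: two of them are adjacent iff they
have nonempty intersection and are incomparable with respect to inclusion. -/
def idealGraph (P : Type*) [PartialOrder P] : SimpleGraph (ConnIdeal P) where
  Adj A B := (A.1 ∩ B.1).Nonempty ∧ ¬ A.1 ⊆ B.1 ∧ ¬ B.1 ⊆ A.1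
  symm := ⟨fun A B h => ⟨by rw [Set.inter_comm]; exact h.1, h.2.2, h.2.1⟩⟩
  loopless := ⟨fun _ h => h.2.1 subset_rfl⟩

noncomputable instance instFintypeComponents (P : Type*) [PartialOrder P] [Finite P] :
    Fintype (idealGraph P).ConnectedComponent :=
  Fintype.ofFinite _

open Classical in
/-- The set of maximum independent sets (independent sets of largest possible size)
of a finite graph. -/
noncomputable def maxIndepSets {V : Type*} [Finite V] (G : SimpleGraph V) :
    Finset (Finset V) :=
  letI := Fintype.ofFinite V
  Finset.univ.filter fun M => G.IsMaximumIndepSet M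

/-- The linear extensions of `P`, labelled by `{0, …, n - 1}` through `ω`: the permutations
`w` of the labels such that `i < j` whenever the element labelled `w i` is smaller in `P` than
the element labelled `w j`. -/
def linearExtensions {P : Type*} [PartialOrder P] {n : ℕ} (ω : P ≃ Fin n) :
    Set (Equiv.Perm (Fin n)) :=
  {w | ∀ i j : Fin n, ω.symm (w i) < ω.symm (w j) → i < j}

end PosetCount

/-! Independence in `idealGraph P` means laminarity: two members of the family that meet are nested.
In a laminar family each member `J` has an element lying in no smaller member, since otherwise `J`
would split into disjoint lower sets (`exists_top`). Choosing such elements is injective, so a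
laminar family inside `I` has at most `|I|` members. The bound is attained on lower sets, so the
maximum independent sets are the tubings of `P` (`maxIndepSets_idealGraph`).

Let `T(I)` be the sum over the tubings of `I` of the product of all `1/|J|`. The maximal members of
a tubing partition `I`, and deleting one of them amounts to deleting a maximal element `x` of `I`.
Hence `|I| T(I) = ∑ T(I \ x)` (`card_mul_tubingSum`). The number `e(I)` of linear extensions
satisfies `e(I) = ∑ e(I \ x)`, so `e(I) = |I|! T(I)` by induction. Finally the sum over maximum
independent sets of a graph factors over its components. -/

namespace PosetCount

/-! ### Maximum independent sets and connected components of a graph. -/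

section GraphComponents

variable {V : Type*} {G : SimpleGraph V}

theorem mem_maxIndepSets [Finite V] {M : Finset V} :
    M ∈ maxIndepSets G ↔ G.IsMaximumIndepSet M := by
  simp [maxIndepSets]

open Classical in
/-- The part of a set of vertices that lies in a given connected component. -/
noncomputable def restrictComponent (M : Finset V) (C : G.ConnectedComponent) : Finset C :=
  M.subtype (· ∈ C)

open Classical in
/-- The union of a family of sets of vertices, one in each connected component. -/
noncomputable def glueComponents [Fintype V] (p : ∀ C : G.ConnectedComponent, Finset C) :
    Finset V :=
  Finset.univ.filter fun v => ⟨v, rfl⟩ ∈ p (G.connectedComponentMk v)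

theorem mem_restrictComponent {M : Finset V} {C : G.ConnectedComponent} {v : C} :
    v ∈ restrictComponent M C ↔ (v : V) ∈ M := by
  simp [restrictComponent]

theorem mem_glueComponents [Fintype V] {p : ∀ C : G.ConnectedComponent, Finset C}
    {C : G.ConnectedComponent} (v : C) : (v : V) ∈ glueComponents p ↔ v ∈ p C := by
  obtain ⟨v, rfl⟩ := v
  simp [glueComponents]

theorem restrictComponent_glueComponents [Fintype V]
    (p : ∀ C : G.ConnectedComponent, Finset C) : restrictComponent (glueComponents p) = p := by
  ext C v
  rw [mem_restrictComponent, mem_glueComponents]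

theorem glueComponents_restrictComponent [Fintype V] (M : Finset V) :
    glueComponents (restrictComponent (G := G) M) = M := by
  ext v
  exact (mem_glueComponents (⟨v, rfl⟩ : G.connectedComponentMk v)).trans mem_restrictComponent

theorem prod_restrictComponent [Fintype G.ConnectedComponent] {R : Type*} [CommMonoid R]
    (w : V → R) (M : Finset V) :
    ∏ C : G.ConnectedComponent, ∏ v ∈ restrictComponent M C, w v = ∏ v ∈ M, w v := by
  classical
  rw [← Finset.prod_fiberwise M G.connectedComponentMk w]
  refine Finset.prod_congr rfl fun C _ => ?_
  have h := Finset.prod_subtype_eq_prod_filter (s := M) (p := (· ∈ C)) w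
  rw [restrictComponent, h]
  rfl

theorem sum_card_restrictComponent [Fintype G.ConnectedComponent] (M : Finset V) :
    ∑ C : G.ConnectedComponent, (restrictComponent M C).card = M.card := by
  -- The product formula in `Multiplicative ℕ`, with constant weight, counts elements.
  have h := prod_restrictComponent (G := G) (fun _ => Multiplicative.ofAdd 1) M
  simpa [← ofAdd_nsmul, ← ofAdd_sum] using h

theorem isIndepSet_iff_restrictComponent {M : Finset V} :
    G.IsIndepSet (M : Set V) ↔
      ∀ C : G.ConnectedComponent,
        C.toSimpleGraph.IsIndepSet (restrictComponent M C : Set C) := by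
  constructor
  · intro h C u hu v hv huv hadj
    exact h (mem_restrictComponent.1 hu) (mem_restrictComponent.1 hv)
      (fun h' => huv (Subtype.ext h')) hadj
  · intro h u hu v hv huv hadj
    refine h (G.connectedComponentMk u) (x := ⟨u, rfl⟩) (mem_restrictComponent.2 hu)
      (y := ⟨v, SimpleGraph.ConnectedComponent.sound hadj.symm.reachable⟩)
      (mem_restrictComponent.2 hv) (fun h' => huv (congrArg Subtype.val h')) hadj

theorem isMaximumIndepSet_iff_restrictComponent [Fintype V] [Fintype G.ConnectedComponent]
    {M : Finset V} :
    G.IsMaximumIndepSet M ↔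
      ∀ C : G.ConnectedComponent, C.toSimpleGraph.IsMaximumIndepSet (restrictComponent M C) := by
  classical
  constructor
  · intro h C
    refine ⟨isIndepSet_iff_restrictComponent.1 h.isIndepSet C, fun t ht => ?_⟩
    -- Exchanging only the part of `M` in `C` for a larger `t` would enlarge `M`.
    let p := Function.update (restrictComponent (G := G) M) C t
    have hp : G.IsIndepSet (glueComponents p : Set V) := by
      rw [isIndepSet_iff_restrictComponent, restrictComponent_glueComponents]
      intro D
      by_cases hD : D = C
      · subst hD
        simpa [p] using ht
      · simpa [p, hD] using isIndepSet_iff_restrictComponent.1 h.isIndepSet D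
    by_contra! hlt
    refine (h.maximum _ hp).not_gt ?_
    rw [← sum_card_restrictComponent (G := G) M, ← sum_card_restrictComponent (G := G)
      (glueComponents p), restrictComponent_glueComponents]
    refine Finset.sum_lt_sum (fun D _ => ?_) ⟨C, Finset.mem_univ _, by simpa [p] using hlt⟩
    by_cases hD : D = C
    · subst hD
      simpa [p] using hlt.le
    · simp [p, hD]
  · intro h
    refine ⟨isIndepSet_iff_restrictComponent.2 fun C => (h C).isIndepSet, fun t ht => ?_⟩
    rw [← sum_card_restrictComponent (G := G) M, ← sum_card_restrictComponent (G := G) t]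
    exact Finset.sum_le_sum fun C _ =>
      (h C).maximum _ (isIndepSet_iff_restrictComponent.1 ht C)

/-- The generating function of the maximum independent sets of a finite graph is the product of
those of its connected components. -/
theorem sum_maxIndepSets_eq_prod_components [Fintype V] [Fintype G.ConnectedComponent]
    {R : Type*} [CommSemiring R] (w : V → R) :
    ∑ M ∈ maxIndepSets G, ∏ v ∈ M, w v =
      ∏ C : G.ConnectedComponent, ∑ M ∈ maxIndepSets C.toSimpleGraph, ∏ v ∈ M, w v := by
  classical
  rw [Finset.prod_univ_sum]
  refine Finset.sum_nbij' (fun M => restrictComponent M) glueComponents ?_ ?_ ?_ ?_ ?_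
  · intro M hM
    rw [Fintype.mem_piFinset]
    exact fun C =>
      mem_maxIndepSets.2 (isMaximumIndepSet_iff_restrictComponent.1 (mem_maxIndepSets.1 hM) C)
  · intro p hp
    rw [Fintype.mem_piFinset] at hp
    rw [mem_maxIndepSets, isMaximumIndepSet_iff_restrictComponent,
      restrictComponent_glueComponents]
    exact fun C => mem_maxIndepSets.1 (hp C)
  · exact fun M _ => glueComponents_restrictComponent M
  · exact fun p _ => restrictComponent_glueComponents p
  · exact fun M _ => (prod_restrictComponent w M).symm

end GraphComponents


/-! ### Linear extensions as lists, and their recursion. -/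

section Lists

variable {P : Type*} [PartialOrder P]

/-- `l` lists the elements of `I` without repetition, no element being smaller than a later
one. -/
structure IsReverseLinearExtension (I : Finset P) (l : List P) : Prop where
  nodup : l.Nodup
  mem_iff : ∀ x, x ∈ l ↔ x ∈ I
  pairwise : l.Pairwise fun a b => ¬ a < b

theorem finite_isReverseLinearExtension (I : Finset P) :
    Finite {l : List P // IsReverseLinearExtension I l} := by
  classical
  refine Set.Finite.to_subtype (Set.Finite.subset (I.val.lists.toFinset.finite_toSet) ?_)
  intro l hl
  simp only [Finset.mem_coe, Multiset.mem_toFinset, Multiset.mem_lists_iff]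
  exact (Multiset.Nodup.ext I.nodup (Multiset.coe_nodup.2 hl.nodup)).2
    fun x => (hl.mem_iff x).symm

open Classical in
/-- The maximal elements of a finite subset of a partial order. -/
noncomputable def maximals (I : Finset P) : Finset P :=
  I.filter fun x => ∀ y ∈ I, ¬ x < y

theorem mem_maximals {I : Finset P} {x : P} : x ∈ maximals I ↔ x ∈ I ∧ ∀ y ∈ I, ¬ x < y := by
  simp [maximals]

/-- Listing from the top down puts a maximal element at the head, so the tail lives on a set that is
still a lower set whenever `I` is one. -/
theorem isReverseLinearExtension_cons [DecidableEq P] {I : Finset P} {x : P} {l : List P} :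
    IsReverseLinearExtension I (x :: l) ↔
      x ∈ maximals I ∧ IsReverseLinearExtension (I.erase x) l := by
  constructor
  · rintro ⟨h1, h2, h3⟩
    rw [List.nodup_cons] at h1
    rw [List.pairwise_cons] at h3
    have hx : x ∈ I := (h2 x).1 (by simp)
    refine ⟨mem_maximals.2 ⟨hx, fun y hy hxy => ?_⟩, h1.2, fun y => ?_, h3.2⟩
    · rcases List.mem_cons.1 ((h2 y).2 hy) with rfl | h
      · exact lt_irrefl _ hxy
      · exact h3.1 y h hxy
    · rw [Finset.mem_erase, ← h2 y, List.mem_cons]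
      constructor
      · intro h
        exact ⟨fun e => h1.1 (e ▸ h), Or.inr h⟩
      · rintro ⟨h, h' | h'⟩
        · exact absurd h' h
        · exact h'
  · rintro ⟨hx, h1, h2, h3⟩
    rw [mem_maximals] at hx
    refine ⟨List.nodup_cons.2 ⟨fun h => by simpa using (h2 x).1 h, h1⟩, fun y => ?_,
      List.pairwise_cons.2 ⟨fun y hy => hx.2 y (Finset.mem_of_mem_erase ((h2 y).1 hy)), h3⟩⟩
    rw [List.mem_cons, h2 y, Finset.mem_erase]
    by_cases h : y = x
    · simp [h, hx.1]
    · simp [h]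

/-- The number of linear extensions of the subposet `I`. -/
noncomputable def numExtensions (I : Finset P) : ℕ :=
  Nat.card {l : List P // IsReverseLinearExtension I l}

theorem numExtensions_empty : numExtensions (∅ : Finset P) = 1 := by
  rw [numExtensions, Nat.card_eq_one_iff_exists]
  refine ⟨⟨[], by simp, by simp, by simp⟩, fun l => Subtype.ext ?_⟩
  exact List.eq_nil_iff_forall_not_mem.2 fun x hx => by simpa using (l.2.mem_iff x).1 hx

theorem numExtensions_eq_sum [DecidableEq P] {I : Finset P} (hI : I.Nonempty) :
    numExtensions I = ∑ x ∈ maximals I, numExtensions (I.erase x) := by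
  have := fun I : Finset P => finite_isReverseLinearExtension I
  rw [← Finset.sum_coe_sort (maximals I) fun x => numExtensions (I.erase x)]
  simp only [numExtensions]
  rw [← Nat.card_sigma]
  refine (Nat.card_congr (Equiv.ofBijective (fun s => ⟨s.1.1 :: s.2.1,
    isReverseLinearExtension_cons.2 ⟨s.1.2, s.2.2⟩⟩) ⟨?_, ?_⟩)).symm
  · rintro ⟨⟨x, hx⟩, l, hl⟩ ⟨⟨y, hy⟩, m, hm⟩ h
    simp only [Subtype.mk.injEq, List.cons.injEq] at h
    obtain ⟨rfl, rfl⟩ := h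
    rfl
  · rintro ⟨_ | ⟨x, l⟩, hl⟩
    · obtain ⟨x, hx⟩ := hI
      simpa using (hl.mem_iff x).2 hx
    · have h := isReverseLinearExtension_cons.1 hl
      exact ⟨⟨⟨x, h.1⟩, l, h.2⟩, rfl⟩

/-- Reading `w` backwards through `ω.symm` gives the list; the labeling serves only as a bijection.
-/
theorem ncard_linearExtensions [Fintype P] {n : ℕ} (ω : P ≃ Fin n) :
    (linearExtensions ω).ncard = numExtensions (Finset.univ : Finset P) := by
  rw [← Nat.card_coe_set_eq, numExtensions]
  have hrev : ∀ w : Equiv.Perm (Fin n), w ∈ linearExtensions ω ↔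
      IsReverseLinearExtension Finset.univ (List.ofFn fun i => ω.symm (w i.rev)) := by
    intro w
    constructor
    · intro hw
      refine ⟨List.nodup_ofFn.2 (ω.symm.injective.comp
        (w.injective.comp Fin.rev_injective)), fun x => ?_, List.pairwise_ofFn.2 ?_⟩
      · simp only [List.mem_ofFn, Finset.mem_univ, iff_true]
        exact ⟨(w.symm (ω x)).rev, by simp⟩
      · intro i j hij hlt
        exact lt_asymm hij (Fin.rev_lt_rev.1 (hw _ _ hlt))
    · intro h i j hlt
      have hp := List.pairwise_ofFn.1 h.pairwise
      rcases lt_trichotomy i j with hij | hij | hij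
      · exact hij
      · subst hij
        exact absurd hlt (lt_irrefl _)
      · have := hp (Fin.rev_lt_rev.2 hij)
        simp only [Fin.rev_rev] at this
        exact absurd hlt this
  refine Nat.card_congr (Equiv.ofBijective (fun w => ⟨_, (hrev w.1).1 w.2⟩) ⟨?_, ?_⟩)
  · intro v w h
    have h' := List.ofFn_injective (congrArg Subtype.val h)
    refine Subtype.ext (Equiv.ext fun i => ?_)
    have := ω.symm.injective (congrFun h' i.rev)
    simpa using this
  · rintro ⟨l, hl⟩
    have hlen : l.length = n := by
      classical
      have h1 : l.toFinset = Finset.univ := by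
        ext x
        simp [hl.mem_iff x]
      rw [← List.toFinset_card_of_nodup hl.nodup, h1, Finset.card_univ, Fintype.card_congr ω,
        Fintype.card_fin]
    subst hlen
    have hinj : Function.Injective fun i : Fin l.length => ω (l.get i.rev) :=
      ω.injective.comp ((List.nodup_iff_injective_get.1 hl.nodup).comp Fin.rev_injective)
    let w : Equiv.Perm (Fin l.length) :=
      Equiv.ofBijective _ (Finite.injective_iff_bijective.1 hinj)
    have hw : (List.ofFn fun i => ω.symm (w i.rev)) = l := by
      change (List.ofFn fun i : Fin l.length => ω.symm (ω (l.get i.rev.rev))) = l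
      simp only [Equiv.symm_apply_apply, Fin.rev_rev, List.ofFn_get]
    exact ⟨⟨w, (hrev w).2 (by rw [hw]; exact hl)⟩, Subtype.ext hw⟩

end Lists


/-! ### Connected order ideals and components of a lower set. -/

section Ideals

variable {P : Type*} [PartialOrder P]

theorem reachable_hasse_of_le {Q : Type*} [PartialOrder Q] [Finite Q] {a b : Q} (h : a ≤ b) :
    (SimpleGraph.hasse Q).Reachable a b := by
  classical
  have := Fintype.ofFinite Q
  let _ : LocallyFiniteOrder Q := Fintype.toLocallyFiniteOrder
  induction le_iff_reflTransGen_covBy.1 h with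
  | refl => rfl
  | tail _ hcov ih =>
    have hle := le_iff_reflTransGen_covBy.2 (by assumption)
    exact (ih hle).trans (SimpleGraph.Adj.reachable (Or.inl hcov))

/-- The Hasse diagram of a lower set is connected iff the set is nonempty and not the union of
two disjoint nonempty lower sets. -/
theorem connected_hasse_iff [Finite P] {J : Set P} (hJ : IsLowerSet J) :
    (SimpleGraph.hasse J).Connected ↔ J.Nonempty ∧
      ∀ A B : Set P, IsLowerSet A → IsLowerSet B → A ∪ B = J → Disjoint A B → A.Nonempty →
        A = J := by
  constructor
  · intro h
    refine ⟨Set.nonempty_coe_sort.1 h.nonempty, fun A B hA hB hAB hd hne => ?_⟩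
    obtain ⟨a, ha⟩ := hne
    have hAJ : A ⊆ J := hAB ▸ Set.subset_union_left
    refine hAJ.antisymm fun b hb => ?_
    have key : ∀ {u v : J}, (SimpleGraph.hasse J).Reachable u v → (u : P) ∈ A → (v : P) ∈ A := by
      rintro u v ⟨p⟩ hu
      induction p with
      | nil => exact hu
      | @cons u v w huv _ ih =>
        refine ih ?_
        rcases huv with huv | huv
        · have hv : (v : P) ∈ A ∪ B := hAB ▸ v.2
          refine hv.resolve_right fun hv => ?_
          exact Set.disjoint_left.1 hd hu (hB (a := (v : P)) huv.le hv)
        · exact hA (a := (u : P)) huv.le hu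
    exact key (h.preconnected ⟨a, hAJ ha⟩ ⟨b, hb⟩) ha
  · rintro ⟨⟨a, ha⟩, h⟩
    -- The elements reachable from `a` and their complement in `J` are both lower sets.
    let A : Set P := {x | ∃ hx : x ∈ J, (SimpleGraph.hasse J).Reachable ⟨a, ha⟩ ⟨x, hx⟩}
    have hA : IsLowerSet A := by
      rintro x y hyx ⟨hx, hr⟩
      exact ⟨hJ hyx hx, hr.trans (reachable_hasse_of_le (Q := J) (a := ⟨y, hJ hyx hx⟩)
        (b := ⟨x, hx⟩) hyx).symm⟩
    have hB : IsLowerSet (J \ A) := by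
      rintro x y hyx ⟨hx, hr⟩
      refine ⟨hJ hyx hx, fun ⟨hy, hr'⟩ => hr ⟨hx, hr'.trans ?_⟩⟩
      exact reachable_hasse_of_le (Q := J) (a := ⟨y, hy⟩) (b := ⟨x, hx⟩) hyx
    have hAJ : A = J := h A (J \ A) hA hB (Set.union_sdiff_cancel fun x hx => hx.1)
      Set.disjoint_sdiff_right ⟨a, ha, SimpleGraph.Reachable.refl _⟩
    have hreach : ∀ x : J, (SimpleGraph.hasse J).Reachable ⟨a, ha⟩ x := by
      intro x
      have hx : (x : P) ∈ A := hAJ.symm ▸ x.2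
      exact hx.2
    exact { preconnected := fun x y => (hreach x).symm.trans (hreach y), nonempty := ⟨⟨a, ha⟩⟩ }

namespace ConnIdeal

theorem nonempty (J : ConnIdeal P) : J.1.Nonempty :=
  Set.nonempty_coe_sort.1 J.2.2.nonempty

theorem eq_of_union [Finite P] (J : ConnIdeal P) {A B : Set P} (hA : IsLowerSet A)
    (hB : IsLowerSet B) (hAB : A ∪ B = J.1) (hd : Disjoint A B) (hne : A.Nonempty) : A = J.1 :=
  ((connected_hasse_iff J.2.1).1 J.2.2).2 A B hA hB hAB hd hne

end ConnIdeal

/-- The connected component of `x` in the lower set `I`: the intersection of the lower sets that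
contain `x` and whose complement in `I` is a lower set. -/
def componentSet (I : Set P) (x : P) : Set P :=
  {y ∈ I | ∀ A : Set P, IsLowerSet A → IsLowerSet (I \ A) → x ∈ A → y ∈ A}

theorem isLowerSet_componentSet {I : Set P} (hI : IsLowerSet I) (x : P) :
    IsLowerSet (componentSet I x) :=
  fun _ _ hba ha => ⟨hI hba ha.1, fun A hA hIA hx => hA hba (ha.2 A hA hIA hx)⟩

theorem isLowerSet_diff_componentSet {I : Set P} (hI : IsLowerSet I) (x : P) :
    IsLowerSet (I \ componentSet I x) := by
  rintro a b hba ⟨ha, hna⟩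
  refine ⟨hI hba ha, fun hb => hna ⟨ha, fun A hA hIA hx => ?_⟩⟩
  by_contra haA
  exact (hIA hba ⟨ha, haA⟩).2 (hb.2 A hA hIA hx)

theorem connected_componentSet [Finite P] {I : Set P} (hI : IsLowerSet I) {x : P} (hx : x ∈ I) :
    (SimpleGraph.hasse (componentSet I x)).Connected := by
  rw [connected_hasse_iff (isLowerSet_componentSet hI x)]
  have hxC : x ∈ componentSet I x := ⟨hx, fun _ _ _ h => h⟩
  -- If `x ∈ A`, then `A` is one of the sets intersected in `componentSet I x`, because `I \ A` is a
  -- union of two lower sets.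
  have key : ∀ A B : Set P, IsLowerSet A → IsLowerSet B → A ∪ B = componentSet I x →
      Disjoint A B → x ∈ A → A = componentSet I x := by
    intro A B hA hB hAB hd hxA
    refine Set.Subset.antisymm (hAB ▸ Set.subset_union_left) fun y hy => hy.2 A hA ?_ hxA
    have : I \ A = (I \ componentSet I x) ∪ B := by
      ext z
      have h1 : z ∈ componentSet I x ↔ z ∈ A ∨ z ∈ B := by rw [← hAB]; rfl
      have h2 : z ∈ A → z ∉ B := fun h => Set.disjoint_left.1 hd h
      have h3 : z ∈ componentSet I x → z ∈ I := fun h => h.1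
      simp only [Set.mem_sdiff, Set.mem_union]
      tauto
    rw [this]
    exact (isLowerSet_diff_componentSet hI x).union hB
  refine ⟨⟨x, hxC⟩, fun A B hA hB hAB hd ⟨a, ha⟩ => ?_⟩
  rcases (hAB.symm ▸ hxC : x ∈ A ∪ B) with h | h
  · exact key A B hA hB hAB hd h
  · have hBC := key B A hB hA (by rw [Set.union_comm]; exact hAB) hd.symm h
    exact absurd (hBC.symm ▸ hAB ▸ Or.inl ha : a ∈ B) (Set.disjoint_left.1 hd ha)

/-- The connected component of `x` in the lower set `I`, as a connected order ideal. -/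
def componentIdeal [Finite P] {I : Set P} (hI : IsLowerSet I) {x : P} (hx : x ∈ I) :
    ConnIdeal P :=
  ⟨componentSet I x, isLowerSet_componentSet hI x, connected_componentSet hI hx⟩

theorem mem_componentIdeal [Finite P] {I : Set P} (hI : IsLowerSet I) {x : P} (hx : x ∈ I) :
    x ∈ (componentIdeal hI hx).1 :=
  ⟨hx, fun _ _ _ h => h⟩

theorem componentIdeal_subset [Finite P] {I : Set P} (hI : IsLowerSet I) {x : P} (hx : x ∈ I) :
    (componentIdeal hI hx).1 ⊆ I :=
  fun _ h => h.1

/-- The component cuts `J` into two disjoint lower sets, and `J` is connected. -/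
theorem subset_componentIdeal [Finite P] {I : Set P} (hI : IsLowerSet I) {x : P} (hx : x ∈ I)
    {J : ConnIdeal P} (hJ : J.1 ⊆ I) (h : (J.1 ∩ (componentIdeal hI hx).1).Nonempty) :
    J.1 ⊆ (componentIdeal hI hx).1 := by
  have h1 : IsLowerSet (J.1 \ componentSet I x) := by
    have : J.1 \ componentSet I x = J.1 ∩ (I \ componentSet I x) := by
      ext z
      have := @hJ z
      simp only [Set.mem_sdiff, Set.mem_inter_iff]
      tauto
    rw [this]
    exact J.2.1.inter (isLowerSet_diff_componentSet hI x)
  have h2 := J.eq_of_union (J.2.1.inter (isLowerSet_componentSet hI x)) h1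
    (Set.inter_union_sdiff _ _) (Set.disjoint_sdiff_right.mono_left Set.inter_subset_right) h
  rw [← h2]
  exact Set.inter_subset_right

end Ideals


/-! ### Laminar families, tubings and their weighted sum. -/

section Tubings

variable {P : Type*} [PartialOrder P]

theorem isIndepSet_idealGraph_iff {M : Set (ConnIdeal P)} :
    (idealGraph P).IsIndepSet M ↔
      ∀ A ∈ M, ∀ B ∈ M, (A.1 ∩ B.1).Nonempty → A.1 ⊆ B.1 ∨ B.1 ⊆ A.1 := by
  constructor
  · intro h A hA B hB hAB
    by_contra! hn
    exact h hA hB (fun e => hn.1 (e ▸ subset_rfl)) ⟨hAB, hn.1, hn.2⟩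
  · intro h A hA B hB _ hadj
    exact (h A hA B hB hadj.1).elim hadj.2.1 hadj.2.2

/-- A connected ideal of a laminar family is not the union of the smaller members of the
family. -/
theorem exists_top [Finite P] {M : Finset (ConnIdeal P)}
    (hM : (idealGraph P).IsIndepSet (M : Set (ConnIdeal P))) {J : ConnIdeal P} (hJ : J ∈ M) :
    ∃ x ∈ J.1, ∀ K ∈ M, x ∈ K.1 → J.1 ⊆ K.1 := by
  classical
  rw [isIndepSet_idealGraph_iff] at hM
  by_contra! hcon
  have hlt : ∀ x ∈ J.1, ∃ K ∈ M.filter fun K => K < J, x ∈ K.1 := by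
    intro x hx
    obtain ⟨K, hK, hxK, hn⟩ := hcon x hx
    have hKJ : K.1 ⊆ J.1 := (hM J hJ K hK ⟨x, hx, hxK⟩).resolve_left hn
    exact ⟨K, Finset.mem_filter.2 ⟨hK, lt_of_le_not_ge hKJ hn⟩, hxK⟩
  obtain ⟨x₀, hx₀⟩ := J.nonempty
  obtain ⟨K₀, hK₀, -⟩ := hlt x₀ hx₀
  -- `A` is a maximal member strictly inside `J`. A member below `J` that meets `A` is contained in
  -- `A`, so the others are disjoint from `A` and their union `B` completes a splitting of `J`.
  obtain ⟨A, hA⟩ := Finset.exists_maximal ⟨K₀, hK₀⟩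
  have hAS := Finset.mem_filter.1 hA.prop
  have hAJ : A.1 ⊆ J.1 := hAS.2.le
  let B : Set P := {x | ∃ K ∈ M.filter fun K => K < J, ¬ K.1 ⊆ A.1 ∧ x ∈ K.1}
  have hB : IsLowerSet B := by
    rintro a b hba ⟨K, hK, hn, ha⟩
    exact ⟨K, hK, hn, K.2.1 hba ha⟩
  have hU : A.1 ∪ B = J.1 := by
    refine Set.Subset.antisymm (Set.union_subset hAJ ?_) fun x hx => ?_
    · rintro x ⟨K, hK, -, hx⟩
      exact (Finset.mem_filter.1 hK).2.le hx
    · obtain ⟨K, hK, hxK⟩ := hlt x hx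
      by_cases hn : K.1 ⊆ A.1
      · exact Or.inl (hn hxK)
      · exact Or.inr ⟨K, hK, hn, hxK⟩
  have hd : Disjoint A.1 B := by
    rw [Set.disjoint_left]
    rintro x hxA ⟨K, hK, hn, hxK⟩
    have hAK := (hM A hAS.1 K (Finset.mem_filter.1 hK).1 ⟨x, hxA, hxK⟩).resolve_right hn
    exact hn (hA.le_of_ge hK hAK)
  have hAJ' := J.eq_of_union A.2.1 hB hU hd A.nonempty
  exact hAS.2.ne (Subtype.ext hAJ')

theorem exists_injOn_top [Finite P] {M : Finset (ConnIdeal P)}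
    (hM : (idealGraph P).IsIndepSet (M : Set (ConnIdeal P))) :
    ∃ t : ConnIdeal P → P, (∀ J ∈ M, t J ∈ J.1 ∧ ∀ K ∈ M, t J ∈ K.1 → J.1 ⊆ K.1) ∧
      Set.InjOn t M := by
  have h : ∀ J : ConnIdeal P, ∃ x, J ∈ M → x ∈ J.1 ∧ ∀ K ∈ M, x ∈ K.1 → J.1 ⊆ K.1 := by
    intro J
    by_cases hJ : J ∈ M
    · obtain ⟨x, hx⟩ := exists_top hM hJ
      exact ⟨x, fun _ => hx⟩
    · exact ⟨J.nonempty.some, fun h => absurd h hJ⟩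
  choose t ht using h
  refine ⟨t, ht, fun J hJ K hK h => Subtype.ext (Set.Subset.antisymm ?_ ?_)⟩
  · exact (ht J hJ).2 K hK (h ▸ (ht K hK).1)
  · exact (ht K hK).2 J hJ (h ▸ (ht J hJ).1)

theorem card_le_of_isIndepSet [Finite P] {M : Finset (ConnIdeal P)}
    (hM : (idealGraph P).IsIndepSet (M : Set (ConnIdeal P))) {I : Finset P}
    (hI : ∀ J ∈ M, J.1 ⊆ I) : M.card ≤ I.card := by
  obtain ⟨t, ht, hinj⟩ := exists_injOn_top hM
  exact Finset.card_le_card_of_injOn t (fun J hJ => hI J hJ (ht J hJ).1) hinj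

/-- A laminar family of connected ideals contained in `I` with as many members as `I` has
elements. -/
structure IsTubing (I : Finset P) (M : Finset (ConnIdeal P)) : Prop where
  isIndepSet : (idealGraph P).IsIndepSet (M : Set (ConnIdeal P))
  subset : ∀ J ∈ M, J.1 ⊆ I
  card_eq : M.card = I.card

/-- There are as many top elements as elements of `I`, so every element is a top. -/
theorem IsTubing.exists_mem [Finite P] {I : Finset P} {M : Finset (ConnIdeal P)}
    (h : IsTubing I M) {x : P} (hx : x ∈ I) : ∃ J ∈ M, x ∈ J.1 := by
  classical
  obtain ⟨t, ht, hinj⟩ := exists_injOn_top h.isIndepSet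
  have himg : M.image t = I := by
    refine Finset.eq_of_subset_of_card_le ?_ ?_
    · exact Finset.image_subset_iff.2 fun J hJ => h.subset J hJ (ht J hJ).1
    · rw [Finset.card_image_of_injOn hinj, h.card_eq]
  obtain ⟨J, hJ, rfl⟩ := Finset.mem_image.1 (himg ▸ hx)
  exact ⟨J, hJ, (ht J hJ).1⟩

theorem mem_of_mem_maximals {α : Type*} [PartialOrder α] {I : Finset α} {x : α}
    (hx : x ∈ maximals I) : x ∈ I :=
  (mem_maximals.1 hx).1

theorem isLowerSet_erase [DecidableEq P] {I : Finset P} (hI : IsLowerSet (I : Set P)) {x : P}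
    (hx : x ∈ maximals I) : IsLowerSet (I.erase x : Set P) := by
  intro a b hba ha
  simp only [Finset.coe_erase, Set.mem_sdiff, Finset.mem_coe, Set.mem_singleton_iff] at ha ⊢
  refine ⟨hI hba ha.1, ?_⟩
  rintro rfl
  exact (mem_maximals.1 hx).2 a ha.1 (lt_of_le_of_ne hba (Ne.symm ha.2))

theorem isIndepSet_insert_componentIdeal [Finite P] [DecidableEq (ConnIdeal P)] {I : Finset P}
    (hI : IsLowerSet (I : Set P)) {x : P} (hx : x ∈ (I : Set P)) {M : Finset (ConnIdeal P)}
    (hM : (idealGraph P).IsIndepSet (M : Set (ConnIdeal P))) (hMI : ∀ J ∈ M, J.1 ⊆ I) :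
    (idealGraph P).IsIndepSet (insert (componentIdeal hI hx) M : Finset (ConnIdeal P)) := by
  rw [isIndepSet_idealGraph_iff] at hM ⊢
  intro A hA B hB hAB
  rcases Finset.mem_insert.1 (Finset.mem_coe.1 hA) with rfl | hA
  · rcases Finset.mem_insert.1 (Finset.mem_coe.1 hB) with rfl | hB
    · exact Or.inl subset_rfl
    · exact Or.inr (subset_componentIdeal hI hx (hMI B hB) (Set.inter_comm _ _ ▸ hAB))
  · rcases Finset.mem_insert.1 (Finset.mem_coe.1 hB) with rfl | hB
    · exact Or.inl (subset_componentIdeal hI hx (hMI A hA) hAB)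
    · exact hM A hA B hB hAB

theorem IsTubing.componentIdeal_notMem [Finite P] [DecidableEq P] {I : Finset P}
    (hI : IsLowerSet (I : Set P)) {x : P} (hx : x ∈ (I : Set P)) {M : Finset (ConnIdeal P)}
    (hM : IsTubing (I.erase x) M) : componentIdeal hI hx ∉ M := by
  intro h
  have := hM.subset _ h (mem_componentIdeal hI hx)
  simp at this

theorem IsTubing.insert_componentIdeal [Finite P] [DecidableEq P] [DecidableEq (ConnIdeal P)]
    {I : Finset P} (hI : IsLowerSet (I : Set P)) {x : P} (hx : x ∈ (I : Set P))
    {M : Finset (ConnIdeal P)} (hM : IsTubing (I.erase x) M) :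
    IsTubing I (insert (componentIdeal hI hx) M) := by
  have hsub : ∀ J ∈ M, J.1 ⊆ (I : Set P) := fun J hJ =>
    (hM.subset J hJ).trans (Finset.coe_subset.2 (Finset.erase_subset x I))
  refine ⟨isIndepSet_insert_componentIdeal hI hx hM.isIndepSet hsub, fun J hJ => ?_, ?_⟩
  · rcases Finset.mem_insert.1 hJ with rfl | hJ
    · exact componentIdeal_subset hI hx
    · exact hsub J hJ
  · rw [Finset.card_insert_of_notMem (hM.componentIdeal_notMem hI hx), hM.card_eq,
      Finset.card_erase_add_one hx]

theorem IsTubing.componentIdeal_mem_maximals [Finite P] [DecidableEq P]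
    [DecidableEq (ConnIdeal P)] {I : Finset P} (hI : IsLowerSet (I : Set P)) {x : P}
    (hx : x ∈ (I : Set P)) {M : Finset (ConnIdeal P)} (hM : IsTubing (I.erase x) M) :
    componentIdeal hI hx ∈ maximals (insert (componentIdeal hI hx) M) := by
  refine mem_maximals.2 ⟨Finset.mem_insert_self _ _, fun J hJ hlt => ?_⟩
  refine hlt.not_ge (subset_componentIdeal hI hx
    ((hM.insert_componentIdeal hI hx).subset J hJ) ?_)
  exact ⟨x, hlt.le (mem_componentIdeal hI hx), mem_componentIdeal hI hx⟩

/-- A maximal member of a tubing is a connected component of the underlying ideal. -/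
theorem IsTubing.eq_componentIdeal [Finite P] {I : Finset P} (hI : IsLowerSet (I : Set P))
    {M : Finset (ConnIdeal P)} (hM : IsTubing I M) {R : ConnIdeal P} (hR : R ∈ maximals M)
    {x : P} (hx : x ∈ (I : Set P)) (hxR : x ∈ R.1) : R = componentIdeal hI hx := by
  classical
  rw [mem_maximals] at hR
  have hle : R ≤ componentIdeal hI hx :=
    subset_componentIdeal hI hx (hM.subset R hR.1) ⟨x, hxR, mem_componentIdeal hI hx⟩
  -- Otherwise adding the component would give a laminar family of `|I| + 1` members in `I`.
  have hmem : componentIdeal hI hx ∈ M := by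
    by_contra hn
    have hcard := card_le_of_isIndepSet
      (isIndepSet_insert_componentIdeal hI hx hM.isIndepSet hM.subset) (I := I) (by
        intro J hJ
        rcases Finset.mem_insert.1 hJ with rfl | hJ
        · exact componentIdeal_subset hI hx
        · exact hM.subset J hJ)
    rw [Finset.card_insert_of_notMem hn, hM.card_eq] at hcard
    omega
  exact hle.eq_of_not_lt (hR.2 _ hmem)

/-- The top `x` of `R` lies in no other member, as `R` is maximal. The remaining members therefore
form a tubing of `I.erase x` and cover it; an element above `x` would lie in one of them, which
would then contain `x`. -/
theorem IsTubing.exists_erase [Finite P] [DecidableEq P] [DecidableEq (ConnIdeal P)]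
    {I : Finset P} {M : Finset (ConnIdeal P)} (hM : IsTubing I M)
    {R : ConnIdeal P} (hR : R ∈ maximals M) :
    ∃ x ∈ maximals I, x ∈ R.1 ∧ IsTubing (I.erase x) (M.erase R) := by
  have hR' := mem_maximals.1 hR
  obtain ⟨x, hxR, hx⟩ := exists_top hM.isIndepSet hR'.1
  have hxI : x ∈ I := hM.subset R hR'.1 hxR
  have hnot : ∀ J ∈ M.erase R, x ∉ J.1 := by
    intro J hJ hxJ
    rw [Finset.mem_erase] at hJ
    exact hR'.2 J hJ.2 (lt_of_le_of_ne (hx J hJ.2 hxJ) (Ne.symm hJ.1))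
  have htub : IsTubing (I.erase x) (M.erase R) := by
    refine ⟨hM.isIndepSet.mono (Finset.coe_subset.2 (Finset.erase_subset _ _)),
      fun J hJ y hy => ?_, ?_⟩
    · refine Finset.mem_coe.2 (Finset.mem_erase.2 ⟨?_, hM.subset J (Finset.mem_of_mem_erase hJ) hy⟩)
      rintro rfl
      exact hnot J hJ hy
    · rw [Finset.card_erase_of_mem hR'.1, Finset.card_erase_of_mem hxI, hM.card_eq]
  refine ⟨x, mem_maximals.2 ⟨hxI, fun y hy hxy => ?_⟩, hxR, htub⟩
  obtain ⟨J, hJ, hyJ⟩ := htub.exists_mem (Finset.mem_erase.2 ⟨hxy.ne', hy⟩)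
  exact hnot J hJ (J.2.1 hxy.le hyJ)

/-- The maximal members cover `I` and, by laminarity, are pairwise disjoint. -/
theorem IsTubing.sum_ncard_maximals [Finite P] {I : Finset P} {M : Finset (ConnIdeal P)}
    (hM : IsTubing I M) : ∑ R ∈ maximals M, R.1.ncard = I.card := by
  classical
  have := Fintype.ofFinite P
  have hunion : I = (maximals M).biUnion fun R => R.1.toFinset := by
    ext x
    simp only [Finset.mem_biUnion, Set.mem_toFinset]
    constructor
    · intro hx
      obtain ⟨J, hJ, hxJ⟩ := hM.exists_mem hx
      obtain ⟨R, hJR, hR⟩ := M.exists_le_maximal hJ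
      exact ⟨R, mem_maximals.2 ⟨hR.prop, fun K hK => hR.not_gt hK⟩, hJR hxJ⟩
    · rintro ⟨R, hR, hx⟩
      exact hM.subset R (mem_of_mem_maximals hR) hx
  rw [hunion, Finset.card_biUnion]
  · exact Finset.sum_congr rfl fun R _ => Set.ncard_eq_toFinset_card' _
  · intro A hA B hB hAB
    rw [Finset.mem_coe, mem_maximals] at hA hB
    simp only [Function.onFun, Finset.disjoint_left]
    intro x hxA hxB
    rw [Set.mem_toFinset] at hxA hxB
    rcases isIndepSet_idealGraph_iff.1 hM.isIndepSet A hA.1 B hB.1 ⟨x, hxA, hxB⟩ with h | h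
    · exact hA.2 B hB.1 (lt_of_le_of_ne h hAB)
    · exact hB.2 A hA.1 (lt_of_le_of_ne h hAB.symm)

/-- The tubings of `I`, as a finite set. -/
noncomputable def tubings [Finite P] (I : Finset P) : Finset (Finset (ConnIdeal P)) :=
  (Set.toFinite {M | IsTubing I M}).toFinset

theorem mem_tubings [Finite P] {I : Finset P} {M : Finset (ConnIdeal P)} :
    M ∈ tubings I ↔ IsTubing I M := by
  simp [tubings]

/-- The sum over all tubings of `I` of the product of the reciprocals of the sizes. -/
noncomputable def tubingSum [Finite P] (I : Finset P) : ℚ :=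
  ∑ M ∈ tubings I, ∏ J ∈ M, (J.1.ncard : ℚ)⁻¹

theorem tubingSum_empty [Finite P] : tubingSum (∅ : Finset P) = 1 := by
  have : tubings (∅ : Finset P) = {∅} := by
    ext M
    rw [mem_tubings, Finset.mem_singleton]
    constructor
    · intro h
      simpa using h.card_eq
    · rintro rfl
      exact ⟨by simp, by simp, by simp⟩
  simp [tubingSum, this]

theorem ConnIdeal.ncard_ne_zero [Finite P] (J : ConnIdeal P) : (J.1.ncard : ℚ) ≠ 0 :=
  Nat.cast_ne_zero.2 ((Set.ncard_pos (Set.toFinite _)).2 J.nonempty).ne'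

/-- Writing `|I|` as the sum of `|R|` over maximal `R` cancels the factor `1/|R|`. The pairs `(M,
R)` correspond to pairs `(x, M.erase R)`, where `R` is recovered as the component of `x`. -/
theorem card_mul_tubingSum [Finite P] [DecidableEq P] {I : Finset P}
    (hI : IsLowerSet (I : Set P)) :
    (I.card : ℚ) * tubingSum I = ∑ x ∈ maximals I, tubingSum (I.erase x) := by
  classical
  have hleft : (I.card : ℚ) * tubingSum I =
      ∑ M ∈ tubings I, ∑ R ∈ maximals M, R.1.ncard * ∏ J ∈ M, (J.1.ncard : ℚ)⁻¹ := by
    rw [tubingSum, Finset.mul_sum]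
    refine Finset.sum_congr rfl fun M hM => ?_
    rw [← Finset.sum_mul, ← (mem_tubings.1 hM).sum_ncard_maximals, Nat.cast_sum]
  rw [hleft]
  simp only [tubingSum]
  rw [Finset.sum_sigma', Finset.sum_sigma']
  symm
  have hx : ∀ a ∈ (maximals I).sigma fun x => tubings (I.erase x), a.1 ∈ (I : Set P) :=
    fun a ha => mem_of_mem_maximals (Finset.mem_sigma.1 ha).1
  have ht : ∀ a ∈ (maximals I).sigma fun x => tubings (I.erase x), IsTubing (I.erase a.1) a.2 :=
    fun a ha => mem_tubings.1 (Finset.mem_sigma.1 ha).2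
  refine Finset.sum_bij (fun a ha => ⟨insert (componentIdeal hI (hx a ha)) a.2,
    componentIdeal hI (hx a ha)⟩) ?_ ?_ ?_ ?_
  · intro a ha
    exact Finset.mem_sigma.2 ⟨mem_tubings.2 ((ht a ha).insert_componentIdeal hI (hx a ha)),
      (ht a ha).componentIdeal_mem_maximals hI (hx a ha)⟩
  · rintro ⟨x, M⟩ ha ⟨y, N⟩ hb h
    simp only [Sigma.mk.injEq, heq_eq_eq] at h
    have h1 := (ht _ ha).componentIdeal_notMem hI (hx _ ha)
    have h2 := (ht _ hb).componentIdeal_notMem hI (hx _ hb)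
    simp only at h1 h2
    have hMN : M = N := by
      rw [← Finset.erase_insert h1, ← Finset.erase_insert h2, h.1, h.2]
    subst hMN
    -- The common tubing avoids `x`, but would cover it if `y` were a different element.
    suffices x = y by rw [this]
    by_contra hne
    obtain ⟨J, hJ, hxJ⟩ := (ht _ hb).exists_mem (Finset.mem_erase.2 ⟨hne, hx _ ha⟩)
    have := (ht _ ha).subset J hJ hxJ
    simp at this
  · rintro ⟨M, R⟩ hb
    rw [Finset.mem_sigma] at hb
    have hM := mem_tubings.1 hb.1
    obtain ⟨x, hxI, hxR, hM'⟩ := hM.exists_erase hb.2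
    refine ⟨⟨x, M.erase R⟩, Finset.mem_sigma.2 ⟨hxI, mem_tubings.2 hM'⟩, ?_⟩
    have hR := hM.eq_componentIdeal hI hb.2 (mem_of_mem_maximals hxI) hxR
    simp only
    rw [← hR, Finset.insert_erase (mem_of_mem_maximals hb.2)]
  · intro a ha
    rw [Finset.prod_insert ((ht a ha).componentIdeal_notMem hI (hx a ha)),
      mul_inv_cancel_left₀ (ConnIdeal.ncard_ne_zero _)]

theorem maximals_nonempty {I : Finset P} (hI : I.Nonempty) : (maximals I).Nonempty := by
  obtain ⟨x, hx⟩ := I.exists_maximal hI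
  exact ⟨x, mem_maximals.2 ⟨hx.prop, fun y hy => hx.not_gt hy⟩⟩

theorem exists_isTubing [Finite P] (I : Finset P) (hI : IsLowerSet (I : Set P)) :
    ∃ M, IsTubing I M := by
  classical
  induction I using Finset.strongInduction with
  | H I ih =>
    rcases I.eq_empty_or_nonempty with rfl | hne
    · exact ⟨∅, by simp, by simp, by simp⟩
    · obtain ⟨x, hx⟩ := maximals_nonempty hne
      have hxI := mem_of_mem_maximals hx
      obtain ⟨M, hM⟩ := ih _ (Finset.erase_ssubset hxI) (isLowerSet_erase hI hx)
      exact ⟨_, hM.insert_componentIdeal hI hxI⟩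

theorem numExtensions_eq_factorial_mul [Finite P] (I : Finset P)
    (hI : IsLowerSet (I : Set P)) :
    (numExtensions I : ℚ) = (I.card.factorial : ℚ) * tubingSum I := by
  classical
  induction I using Finset.strongInduction with
  | H I ih =>
    rcases I.eq_empty_or_nonempty with rfl | hne
    · simp [numExtensions_empty, tubingSum_empty]
    · obtain ⟨m, hm⟩ := Nat.exists_eq_succ_of_ne_zero hne.card_pos.ne'
      have hsum : ∀ x ∈ maximals I,
          (numExtensions (I.erase x) : ℚ) = (m.factorial : ℚ) * tubingSum (I.erase x) := by
        intro x hx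
        have hxI := mem_of_mem_maximals hx
        rw [ih _ (Finset.erase_ssubset hxI) (isLowerSet_erase hI hx),
          Finset.card_erase_of_mem hxI, hm, Nat.succ_sub_one]
      rw [numExtensions_eq_sum hne, Nat.cast_sum, Finset.sum_congr rfl hsum, ← Finset.mul_sum,
        ← card_mul_tubingSum hI, hm, Nat.factorial_succ]
      push_cast
      ring

theorem maxIndepSets_idealGraph [Fintype P] :
    maxIndepSets (idealGraph P) = tubings (Finset.univ : Finset P) := by
  ext M
  rw [mem_maxIndepSets, mem_tubings]
  have hle : ∀ t : Finset (ConnIdeal P), (idealGraph P).IsIndepSet (t : Set (ConnIdeal P)) →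
      t.card ≤ (Finset.univ : Finset P).card :=
    fun t ht => card_le_of_isIndepSet ht (by simp)
  constructor
  · intro h
    obtain ⟨N, hN⟩ := exists_isTubing (Finset.univ : Finset P) (by simp [isLowerSet_univ])
    exact ⟨h.isIndepSet, by simp,
      (hle M h.isIndepSet).antisymm (hN.card_eq ▸ h.maximum N hN.isIndepSet)⟩
  · intro h
    exact ⟨h.isIndepSet, fun t ht => h.card_eq ▸ hle t ht⟩

end Tubings

end PosetCount

theorem mainTheorem6 {P : Type*} [PartialOrder P] [Finite P] (n : ℕ) (ω : P ≃ Fin n) :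
    ((PosetCount.linearExtensions ω).ncard : ℚ) =
      (n.factorial : ℚ) *
        ∏ C : (PosetCount.idealGraph P).ConnectedComponent,
          ∑ M ∈ PosetCount.maxIndepSets C.toSimpleGraph,
            1 / ∏ J ∈ M, ((J : PosetCount.ConnIdeal P).1.ncard : ℚ) := by
  have := Fintype.ofFinite P
  have := Fintype.ofFinite (PosetCount.ConnIdeal P)
  have hcard : (Finset.univ : Finset P).card = n := by
    rw [Finset.card_univ, Fintype.card_congr ω, Fintype.card_fin]
  have hprod := PosetCount.sum_maxIndepSets_eq_prod_components (G := PosetCount.idealGraph P)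
    fun J => (J.1.ncard : ℚ)⁻¹
  simp only [one_div, ← Finset.prod_inv_distrib]
  rw [PosetCount.ncard_linearExtensions, PosetCount.numExtensions_eq_factorial_mul _
    (by simp [isLowerSet_univ]), hcard, ← hprod, PosetCount.maxIndepSets_idealGraph,
    PosetCount.tubingSum]
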